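/- For $n\ge 0$ let $\lambda=(\lambda_1\ge\lambda_2\ge\cdots\ge\lambda_n\ge 1)$ be a Young diagram with $n$ rows, whose cells are the pairs $(r,c)$ with $1\le r\le n$ and $1\le c\le\lambda_r$ ($r$ is the row and $c$ the column). A \emph{transversal} of $\lambda$ is a permutation $\pi\in S_n$ such that the cell $(\pi(i),i)$ lies in $\lambda$ for every $1\le i\le n$; it is \emph{even} if $\pi$ is an even permutation. A transversal $\pi$ of $\lambda$ \emph{contains} a pattern $\sigma\in S_k$ if there are indices $i_1<i_2<\cdots<i_k$ such that $\pi(i_1)\pi(i_2)\cdots\pi(i_k)$ is order isomorphic to $\sigma$ and the cell $(\max\{\pi(i_1),\ldots,\pi(i_k)\},\,i_k)$ lies in $\lambda$ (equivalently, all the cells $(\pi(i_a),i_b)$ with $1\le a,b\le k$ lie in $\lambda$); otherwise it \emph{avoids} $\sigma$. Two patterns are \emph{even-shape-Wilf-equivalent} if, for every Young diagram $\lambda$, the number of even transversals of $\lambda$ avoiding the first equals the number of even transversals of $\lambda$ avoiding the second. \textbf{Theorem.} For every odd positive integer $t$, the permutations $J_t=t(t-1)\cdots 21$ and $F_t=(t-1)(t-2)\cdots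 21\,t$ in $S_t$ are even-shape-Wilf-equivalent. -/

import Mathlib

namespace EvenShapeWilf

/-- The decreasing pattern `J_t = t (t-1) ⋯ 2 1`. -/
def J (t : ℕ) : Equiv.Perm (Fin t) := Fin.revPerm

/-- The one-line notation of `F_t`, zero-indexed: position `i` has the letter `t - 2 - i` if
`i < t - 1`, and the last position `t - 1` has the largest letter `t - 1`. -/
def FFun (t : ℕ) (i : Fin t) : Fin t :=
  if h : i.val + 1 < t then ⟨t - 2 - i.val, by omega⟩ else i

theorem FFun_involutive (t : ℕ) : Function.Involutive (FFun t) := by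
  intro i
  apply Fin.ext
  have hi := i.isLt
  unfold FFun
  split_ifs with h h' h'
  · simp only
    omega
  · simp only at h'
    omega
  · rfl

/-- The pattern `F_t = (t-1) (t-2) ⋯ 2 1 t`. -/
def F (t : ℕ) : Equiv.Perm (Fin t) := (FFun_involutive t).toPerm

/-- The number of rows of a Young diagram. A cell `(r, c)` of `Y` lies in row `r` and column `c`;
row `0` is the longest row, drawn at the bottom. -/
def numRows (Y : YoungDiagram) : ℕ := Y.colLen 0

/-- A transversal of a Young diagram `Y` with `n` rows is a permutation `π` of `n` letters each
point `(i, π i)` of whose graph lies in a cell of `Y`, in row `π i` and column `i`. -/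
def IsTransversal (Y : YoungDiagram) (π : Equiv.Perm (Fin (numRows Y))) : Prop :=
  ∀ i, ((π i : ℕ), (i : ℕ)) ∈ Y

/-- `π` contains the pattern `σ` in `Y`: for some positions `e 0 < ⋯ < e (k-1)`, the word
`π (e 0) ⋯ π (e (k-1))` is order isomorphic to `σ`, and the rows and columns of these `k` points
form a full `k × k` square in `Y` (for `k > 0`: the cell in the row of the largest of these
letters and in the column of the last of these positions lies in `Y`). -/
def ContainsIn (Y : YoungDiagram) (π : Equiv.Perm (Fin (numRows Y))) {k : ℕ}
    (σ : Equiv.Perm (Fin k)) : Prop :=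
  ∃ e : Fin k ↪o Fin (numRows Y),
    (∀ a b, π (e a) < π (e b) ↔ σ a < σ b) ∧
    (∀ a b, ((π (e a) : ℕ), (e b : ℕ)) ∈ Y)

/-- The even transversals of `Y` that avoid `σ`. -/
def evenAvoiders (Y : YoungDiagram) {k : ℕ} (σ : Equiv.Perm (Fin k)) :
    Set (Equiv.Perm (Fin (numRows Y))) :=
  {π | IsTransversal Y π ∧ Equiv.Perm.sign π = 1 ∧ ¬ ContainsIn Y π σ}

/-- Even-shape-Wilf-equivalence of two patterns: for every Young diagram, equally many even
transversals avoid the one and the other. -/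
def EvenShapeWilfEquiv {k l : ℕ} (σ : Equiv.Perm (Fin k)) (τ : Equiv.Perm (Fin l)) : Prop :=
  ∀ Y : YoungDiagram, (evenAvoiders Y σ).ncard = (evenAvoiders Y τ).ncard

end EvenShapeWilf

/-! Write `t = T + 1` with `T` even. Each pattern is a descending chain of `T` points together with
one larger point, which precedes the chain in `J` and follows it in `F`. Rows are compared by index,
so smaller rows are lower. The sets `stage r` forbid `J` when its largest point lies in one of the
`r` lowest rows and `F` when it lies in another row; they interpolate between the two sets of
avoiders. Consecutive stages have complements, inside one set `hybrid`, given by an occurrence of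
`J`, respectively `F`, with largest point in row `r`, so it suffices to match these complements.

The matching takes the greedy, leftmost occurrence `a 0 = r, a 1, …, a T` of `J` and rotates its
columns, which makes it an occurrence of `F`. This is a `(T + 1)`-cycle, hence an even permutation.
Three facts are needed. The move is invertible: read backwards, the moved chain is greedy for the
reversed orders (`Greedy.dual`). It neither creates the first `J` in the rows below `r` nor destroys
the last (`Greedy.hasChain_of_moved` and its dual). It preserves each condition `FTop` above `r`
(`Greedy.hasChain_moved_of`, `Greedy.hasChain_swap_of_moved`).

All three are exchange arguments. A chain broken by the move crosses the greedy chain and can be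
rerouted along it; otherwise the greedy choice was not leftmost, or there is a chain of `T + 1`
points below `r`, which the absence of lower occurrences of `J` excludes. -/

namespace EvenShapeWilf

/-- `HasChain R P k v`: there is an `R`-chain of `k ≥ 1` elements of `P` starting at `v`. -/
inductive HasChain {V : Type*} (R : V → V → Prop) (P : V → Prop) : ℕ → V → Prop
  | single {v : V} : P v → HasChain R P 1 v
  | cons {k : ℕ} {v w : V} : P v → R v w → HasChain R P k w → HasChain R P (k + 1) v

/-! ### Chains and their reversal -/

namespace HasChain

variable {V : Type*} {R : V → V → Prop} {P : V → Prop}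

theorem mem {k : ℕ} {v : V} (h : HasChain R P k v) : P v := by
  cases h <;> assumption

theorem mono {R' : V → V → Prop} {P' : V → Prop} (hR : ∀ v w, R v w → R' v w)
    (hP : ∀ v, P v → P' v) {k : ℕ} {v : V} (h : HasChain R P k v) : HasChain R' P' k v := by
  induction h with
  | single h => exact single (hP _ h)
  | cons h hr _ ih => exact cons (hP _ h) (hR _ _ hr) ih

theorem le {k : ℕ} {v : V} (h : HasChain R P k v) : ∀ {j : ℕ}, 1 ≤ j → j ≤ k → HasChain R P j v := by
  induction h with
  | single h =>
    intro j h1 h2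
    obtain rfl : j = 1 := by omega
    exact single h
  | @cons k v w h hr _ ih =>
    intro j h1 h2
    rcases j with _ | _ | j
    · omega
    · exact single h
    · exact cons h hr (ih (by omega) (by omega))

theorem join {k : ℕ} {v : V} (h : HasChain R P k v) :
    ∀ {l : ℕ}, HasChain (Function.swap R) P l v →
      ∃ w, HasChain (Function.swap R) P (l + k - 1) w := by
  induction h with
  | single h => exact fun h' => ⟨_, h'⟩
  | @cons k v w h hr hc ih =>
    intro l h'
    obtain ⟨u, hu⟩ := ih (cons hc.mem hr h')
    exact ⟨u, by convert hu using 1; omega⟩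

theorem exists_swap {k : ℕ} {v : V} (h : HasChain R P k v) :
    ∃ w, HasChain (Function.swap R) P k w := by
  obtain ⟨w, hw⟩ := h.join (single h.mem)
  exact ⟨w, by convert hw using 1; omega⟩

theorem exists_of_swap {k : ℕ} {v : V} (h : HasChain (Function.swap R) P k v) :
    ∃ w, HasChain R P k w :=
  h.exists_swap

end HasChain

/-! ### Rotating the columns along a chain -/

section Move

variable {V C : Type*}

/-- The chain `a 0, a 1, …, a T` with its rows `a 1, …, a T` reversed. For a greedy chain this is
the greedy chain of the moved configuration with respect to the reversed orders. -/
def rev (T : ℕ) (a : ℕ → V) (k : ℕ) : V := if k = 0 then a 0 else a (T + 1 - k)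

theorem rev_succ (T : ℕ) (a : ℕ → V) (k : ℕ) : rev T a (k + 1) = a (T - k) := by
  simp [rev]

/-- `p'` arises from `p` by moving the rows `a 1, …, a T` one step to the left along the columns
of `a 0, …, a T`, and the row `a 0` to the last of these columns. -/
structure Moved (p p' : V → C) (T : ℕ) (a : ℕ → V) : Prop where
  succ : ∀ k < T, p' (a (k + 1)) = p (a k)
  zero : p' (a 0) = p (a T)
  other : ∀ v, (∀ k ≤ T, v ≠ a k) → p' v = p v

theorem Moved.rev_col {p p' : V → C} {T : ℕ} {a : ℕ → V} (mv : Moved p p' T a) {k : ℕ} (hk : k ≤ T) :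
    p' (rev T a k) = p (a (T - k)) := by
  unfold rev
  split_ifs with h
  · subst h; exact mv.zero
  · rw [show T + 1 - k = T - k + 1 by omega, mv.succ _ (by omega)]

theorem Moved.symm {p p' : V → C} {T : ℕ} {a : ℕ → V} (mv : Moved p p' T a) : Moved p' p T (rev T a) where
  succ k hk := by
    rw [mv.rev_col hk.le, rev_succ]
  zero := by
    rw [mv.rev_col le_rfl, Nat.sub_self]
    rfl
  other v hv := by
    refine (mv.other v fun k hk e => ?_).symm
    rcases k with _ | k
    · exact hv 0 (Nat.zero_le _) e
    · apply hv (T - k) (by omega)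
      rw [show T - k = T - k - 1 + 1 by omega, rev_succ, e]
      congr 1
      omega

end Move

/-! ### The greedy chain and its self-duality -/

section Greedy

variable {V C : Type*} [LinearOrder V] [LinearOrder C]

/-- The rows `v` and `w`, occupied in the columns `p v` and `p w`, form a descent. -/
def Desc (p : V → C) (v w : V) : Prop := w < v ∧ p v < p w

/-- `a 0, …, a T` is the greedy chain: each row `a (k + 1)` is the leftmost row to the right of
`a k` (and below `a k` when `k ≠ 0`) that starts a chain of `T - k` rows in `Q`. -/
structure Greedy (p : V → C) (Q : V → Prop) (T : ℕ) (a : ℕ → V) : Prop where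
  mem : ∀ k < T, Q (a (k + 1))
  col : ∀ k < T, p (a k) < p (a (k + 1))
  row : ∀ k, k + 1 < T → a (k + 2) < a (k + 1)
  min : ∀ k < T, ∀ v, HasChain (Desc p) Q (T - k) v → p (a k) < p v → (k ≠ 0 → v < a k) →
    p (a (k + 1)) ≤ p v

namespace Greedy

variable {p p' : V → C} {Q P : V → Prop} {T : ℕ} {a : ℕ → V}

theorem col_lt (g : Greedy p Q T a) {j k : ℕ} (hjk : j < k) (hk : k ≤ T) : p (a j) < p (a k) := by
  induction k with
  | zero => omega
  | succ k ih =>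
    rcases Nat.lt_succ_iff_lt_or_eq.mp hjk with h | rfl
    · exact (ih h (by omega)).trans (g.col k (by omega))
    · exact g.col j (by omega)

theorem lt_of_col_lt (g : Greedy p Q T a) {j k : ℕ} (hj : j ≤ T) (h : p (a j) < p (a k)) :
    j < k := by
  by_contra hjk
  rcases Nat.eq_or_lt_of_le (not_lt.mp hjk) with rfl | h'
  · exact lt_irrefl _ h
  · exact lt_asymm h (g.col_lt h' hj)

theorem row_lt (g : Greedy p Q T a) {j k : ℕ} (hj : 1 ≤ j) (hjk : j < k) (hk : k ≤ T) :
    a k < a j := by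
  induction k with
  | zero => omega
  | succ k ih =>
    obtain ⟨k, rfl⟩ : ∃ l, k = l + 1 := ⟨k - 1, by omega⟩
    rcases Nat.lt_succ_iff_lt_or_eq.mp hjk with h | rfl
    · exact (g.row k (by omega)).trans (ih h (by omega))
    · exact g.row k (by omega)

theorem hasChain_add (g : Greedy p Q T a) {k m : ℕ} (hk : k < T)
    (h : HasChain (Desc p) Q m (a (k + 1))) : HasChain (Desc p) Q (m + k) (a 1) := by
  induction k generalizing m with
  | zero => exact h
  | succ k ih =>
    have := ih (by omega) (HasChain.cons (g.mem k (by omega))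
      ⟨g.row k (by omega), g.col (k + 1) (by omega)⟩ h)
    convert this using 1
    omega

theorem hasChain_of_desc (g : Greedy p Q T a) {q : V → C} (hP : ∀ k < T, P (a (k + 1)))
    (hq : ∀ k, k + 1 < T → q (a (k + 1)) < q (a (k + 2))) {k : ℕ} (hk : k < T) :
    HasChain (Desc q) P (T - k) (a (k + 1)) := by
  obtain ⟨d, hd⟩ : ∃ d, T = k + 1 + d := ⟨T - k - 1, by omega⟩
  induction d generalizing k with
  | zero =>
    convert HasChain.single (hP k hk) using 1
    omega
  | succ d ih =>
    convert HasChain.cons (hP k hk) ⟨g.row k (by omega), hq k (by omega)⟩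
      (ih (k := k + 1) (by omega) (by omega)) using 1
    omega

theorem hasChain_of_mem (g : Greedy p Q T a) (hP : ∀ k < T, P (a (k + 1))) {k : ℕ}
    (hk : k < T) : HasChain (Desc p) P (T - k) (a (k + 1)) :=
  g.hasChain_of_desc hP (fun k hk => g.col (k + 1) hk) hk

theorem hasChain (g : Greedy p Q T a) {k : ℕ} (hk : k < T) :
    HasChain (Desc p) Q (T - k) (a (k + 1)) :=
  g.hasChain_of_mem g.mem hk

theorem hasChain_moved (g : Greedy p Q T a) (mv : Moved p p' T a)
    (hP : ∀ k < T, P (a (k + 1))) {k : ℕ} (hk : k < T) :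
    HasChain (Desc p') P (T - k) (a (k + 1)) := by
  refine g.hasChain_of_desc hP (fun k hk => ?_) hk
  rw [mv.succ k (by omega), mv.succ (k + 1) hk]
  exact g.col k (by omega)

/-- Follow both chains downwards. The row `w` lies below `a (s + 2)`, since otherwise `w` followed
by `a (s + 2), …, a T` is a forbidden `Q`-chain. Once the next row `w'` lies to the right of `a (s +
2)`, the given chain can be entered from the greedy one, with one row gained; until then `w'`
inherits the hypotheses. -/
theorem cross (g : Greedy p Q T a) (hinj : Function.Injective p)
    (hP : ∀ w, ∀ k < T, P w → w < a (k + 1) → P (a (k + 1)))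
    (hPQ : ∀ w, P w → p (a 0) < p w → p w < p (a T) → Q w) {k : ℕ} {w : V}
    (h : HasChain (Desc p) P k w) :
    ∀ s < T, p (a 0) < p w → p w < p (a (s + 1)) → w < a (s + 1) →
      ¬ HasChain (Desc p) Q (T - s) w → HasChain (Desc p) P (k + 1) (a (s + 1)) := by
  have key : ∀ {w : V}, P w → ∀ s < T, p (a 0) < p w → p w < p (a (s + 1)) → w < a (s + 1) →
      ¬ HasChain (Desc p) Q (T - s) w → s + 1 < T ∧ w < a (s + 2) := by
    intro w hw s hs h0 h1 h2 h3
    have hQ : Q w := hPQ w hw h0 (by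
      rcases Nat.lt_or_ge (s + 1) T with h | h
      · exact h1.trans (g.col_lt h le_rfl)
      · rwa [show T = s + 1 by omega])
    have hsT : s + 1 < T := by
      by_contra hsT
      exact h3 (by rw [show T - s = 1 by omega]; exact HasChain.single hQ)
    refine ⟨hsT, ?_⟩
    by_contra hlt
    have hcol : p w < p (a (s + 2)) := h1.trans (g.col (s + 1) hsT)
    have hne : a (s + 2) ≠ w := fun e => by rw [e] at hcol; exact lt_irrefl _ hcol
    apply h3
    convert HasChain.cons hQ ⟨lt_of_le_of_ne (not_lt.mp hlt) hne, hcol⟩ (g.hasChain hsT) using 1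
    omega
  induction h with
  | single hw =>
    intro s hs h0 h1 h2 h3
    obtain ⟨hsT, hlt⟩ := key hw s hs h0 h1 h2 h3
    exact .cons (hP _ s hs hw h2) ⟨g.row s hsT, g.col (s + 1) hsT⟩
      (.single (hP _ (s + 1) hsT hw hlt))
  | @cons k w w' hw hr hc ih =>
    intro s hs h0 h1 h2 h3
    obtain ⟨hsT, hlt⟩ := key hw s hs h0 h1 h2 h3
    have hPs := hP _ s hs hw h2
    have hD : Desc p (a (s + 1)) (a (s + 2)) := ⟨g.row s hsT, g.col (s + 1) hsT⟩
    have hlt' : w' < a (s + 2) := hr.1.trans hlt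
    rcases lt_trichotomy (p w') (p (a (s + 2))) with h | h | h
    · refine .cons hPs hD (ih (s + 1) hsT (h0.trans hr.2) h hlt' fun hch => h3 ?_)
      have hQ : Q w := hPQ w hw h0 (by
        exact h1.trans (g.col_lt hsT le_rfl))
      convert HasChain.cons hQ hr hch using 1
      omega
    · exact absurd (hinj h) hlt'.ne
    · exact .cons hPs hD (.cons (hP _ (s + 1) hsT hw hlt) ⟨hlt', h⟩ hc)

/-- A chain of the moved configuration gives a chain of the original one from the same row. -/
theorem hasChain_of_moved (g : Greedy p Q T a) (mv : Moved p p' T a)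
    (hinj : Function.Injective p) (hP0 : ∀ w, P w → w ≠ a 0)
    (hP : ∀ w, ∀ k < T, P w → w < a (k + 1) → P (a (k + 1)))
    (hPQ : ∀ w, P w → p (a 0) < p w → p w < p (a T) → Q w) {k : ℕ} {v : V}
    (h : HasChain (Desc p') P k v) : HasChain (Desc p) P k v := by
  induction h with
  | single hv => exact .single hv
  | @cons k v w hv hr hc ih =>
    rcases lt_trichotomy (p v) (p w) with hvw | hvw | hvw
    · exact .cons hv ⟨hr.1, hvw⟩ ih
    · exact absurd (hinj hvw) hr.1.ne'
    have hw : ∀ k ≤ T, w = a k → ∃ l < T, k = l + 1 := by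
      rintro k hk rfl
      rcases k with _ | k
      · exact absurd rfl (hP0 _ hc.mem)
      · exact ⟨k, by omega, rfl⟩
    have hle : p' w ≤ p w := by
      by_cases hs : ∃ k ≤ T, w = a k
      · obtain ⟨k, hk, e⟩ := hs
        obtain ⟨l, hl, rfl⟩ := hw k hk e
        rw [e, mv.succ l hl]
        exact (g.col l hl).le
      · push Not at hs
        exact (mv.other w hs).le
    by_cases hs : ∃ k ≤ T, v = a k
    swap
    · push Not at hs
      have := mv.other v hs ▸ hr.2
      exact absurd (this.trans_le hle) (not_lt.mpr hvw.le)
    obtain ⟨_ | s, hk, rfl⟩ := hs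
    · exact absurd rfl (hP0 _ hv)
    have hsT : s < T := hk
    have hr2 := hr.2
    rw [mv.succ s hsT] at hr2
    have hne : ∀ k ≤ T, w ≠ a k := by
      intro k hk e
      obtain ⟨l, hl, rfl⟩ := hw k hk e
      rw [e, mv.succ l hl] at hr2
      rw [e] at hvw
      have h1 := g.lt_of_col_lt (by omega) hr2
      have h2 := g.lt_of_col_lt (by omega) hvw
      omega
    rw [mv.other w hne] at hr2
    refine g.cross hinj hP hPQ ih s hsT ?_ hvw hr.1 fun hch => ?_
    · rcases Nat.eq_zero_or_pos s with rfl | h0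
      · exact hr2
      · exact (g.col_lt h0 hsT.le).trans hr2
    · refine absurd (g.min s hsT w hch hr2 fun h0 => ?_) (not_le.mpr hvw)
      exact hr.1.trans (g.row_lt (by omega) (Nat.lt_succ_self s) (by omega))

theorem not_hasChain_moved (g : Greedy p Q T a) (mv : Moved p p' T a)
    (hinj : Function.Injective p) (h0 : ¬ Q (a 0)) (hno : ∀ v, ¬ HasChain (Desc p) Q (T + 1) v)
    (v : V) : ¬ HasChain (Desc p') Q (T + 1) v := fun h =>
  hno v (g.hasChain_of_moved mv hinj (fun _ hw e => h0 (e ▸ hw)) (fun _ k hk _ _ => g.mem k hk)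
    (fun _ hw _ _ => hw) h)

/-- A chain that is moved above `u` and original below it still has at most `T` rows. Climb from `u`
until the moved part meets some `a (q + 1)`. At most `q + 1` rows end there, as the moved greedy
chain continues with `T - q` rows. So the lower part is long enough for the greedy choice to have
considered `u`; hence `u` is to the right of `a (q + 1)`, and `a 1, …, a (q + 1), u, …` is too long.
-/
theorem not_hasChain_of_swap_moved (g : Greedy p Q T a) (mv : Moved p p' T a)
    (hinj : Function.Injective p) (h0 : ¬ Q (a 0)) (hno : ∀ v, ¬ HasChain (Desc p) Q (T + 1) v)
    {s : ℕ} {u : V} (h : HasChain (Function.swap (Desc p')) Q s u) :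
    (∀ k ≤ T, u ≠ a k) → ∀ m, T + 2 ≤ s + m → ¬ HasChain (Desc p) Q m u := by
  induction h with
  | single hu => exact fun _ m hm hc => hno _ (hc.le (by omega) (by omega))
  | @cons s u u' hu hr hc ih =>
    intro hne m hm hch
    have hr2 : p' u' < p' u := hr.2
    rw [mv.other u hne] at hr2
    by_cases hs : ∃ k ≤ T, u' = a k
    swap
    · push Not at hs
      rw [mv.other u' hs] at hr2
      exact ih hs (m + 1) (by omega) (.cons hc.mem ⟨hr.1, hr2⟩ hch)
    obtain ⟨_ | q, hq, rfl⟩ := hs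
    · exact h0 hc.mem
    have hqT : q < T := hq
    have hsq : s ≤ q + 1 := by
      by_contra hlt
      obtain ⟨w, hw⟩ := (g.hasChain_moved mv g.mem hqT).join hc
      obtain ⟨w', hw'⟩ := hw.exists_of_swap
      exact g.not_hasChain_moved mv hinj h0 hno _ (hw'.le (by omega) (by omega))
    rw [mv.succ q hqT] at hr2
    have hmin := g.min q hqT u (hch.le (by omega) (by omega)) hr2 fun h =>
      (show u < a (q + 1) from hr.1).trans (g.row_lt (by omega) (Nat.lt_succ_self q) (by omega))
    have hlt : p (a (q + 1)) < p u := lt_of_le_of_ne hmin fun e => hne _ hq (hinj e).symm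
    exact hno _ ((g.hasChain_add hqT (.cons (g.mem q hqT) ⟨hr.1, hlt⟩ hch)).le
      (by omega) (by omega))

/-- A better choice `v` for the reversed chain would lie strictly between the columns of `a j` and
`a (j + 1)`, and start a `Q`-chain of `T - j` rows. By the original greedy choice `v` is then not
below `a j`, so it can precede `a (j + 1), …, a T`; joined to the moved chain ending at `v`, this
gives `T + 1` rows. -/
theorem dual (g : Greedy p Q T a) (mv : Moved p p' T a)
    (hinj : Function.Injective p) (h0 : ¬ Q (a 0)) (hno : ∀ v, ¬ HasChain (Desc p) Q (T + 1) v) :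
    Greedy (V := Vᵒᵈ) (C := Cᵒᵈ) p' Q T (rev T a) where
  mem k hk := by
    change Q (rev (V := V) T a (k + 1))
    rw [rev_succ, show T - k = T - k - 1 + 1 by omega]
    exact g.mem _ (by omega)
  col k hk := by
    change p' (rev T a (k + 1)) < p' (rev T a k)
    rw [mv.rev_col hk, mv.rev_col hk.le]
    exact g.col_lt (by omega) (by omega)
  row k hk := by
    change rev T a (k + 1) < rev T a (k + 2)
    rw [rev_succ, rev_succ]
    exact g.row_lt (by omega) (by omega) (by omega)
  min := fun k hk (v : V) hch hcol hrow => by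
    change p' v ≤ p' (rev T a (k + 1))
    change p' v < p' (rev T a k) at hcol
    change k ≠ 0 → rev T a k < v at hrow
    replace hch : HasChain (Function.swap (Desc p')) Q (T - k) v := hch
    rw [mv.rev_col hk.le] at hcol
    rw [mv.rev_col hk]
    by_contra hlt
    rw [not_le] at hlt
    obtain ⟨j, hj⟩ : ∃ j, T = k + (j + 1) := ⟨T - k - 1, by omega⟩
    rw [show T - (k + 1) = j by omega] at hlt
    rw [show T - k = j + 1 by omega] at hcol hch
    have hne : ∀ l ≤ T, v ≠ a l := by
      rintro (_ | l) hl rfl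
      · exact h0 hch.mem
      · rw [mv.succ l hl] at hlt hcol
        have h1 := g.lt_of_col_lt (by omega) hlt
        have h2 := g.lt_of_col_lt (by omega) hcol
        omega
    rw [mv.other v hne] at hlt hcol
    have hc : HasChain (Desc p) Q (T - j) v := by
      rcases Nat.eq_zero_or_pos k with rfl | hk0
      · convert HasChain.single hch.mem using 1
        omega
      · have hv := hrow (by omega)
        obtain ⟨l, rfl⟩ : ∃ l, k = l + 1 := ⟨k - 1, by omega⟩
        rw [rev_succ, show T - l = j + 1 + 1 by omega] at hv
        convert HasChain.cons hch.mem ⟨hv, hcol.trans (g.col (j + 1) (by omega))⟩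
          (g.hasChain (k := j + 1) (by omega)) using 1
        omega
    have hv : j ≠ 0 ∧ ¬ v < a j := by
      by_contra hcon
      push Not at hcon
      exact absurd (g.min j (by omega) v hc hlt hcon) (not_le.mpr hcol)
    have hlt' : a (j + 1) < v :=
      (g.row_lt (by omega) (Nat.lt_succ_self j) (by omega)).trans_le (not_lt.mp hv.2)
    exact g.not_hasChain_of_swap_moved mv hinj h0 hno hch hne (T - j + 1) (by omega)
      (.cons hch.mem ⟨hlt', hcol⟩ (g.hasChain (by omega)))

end Greedy
end Greedy
end EvenShapeWilf

/-! ### Existence and uniqueness of the greedy chain; chains left of its last column -/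

namespace EvenShapeWilf
namespace Greedy

variable {V C : Type*} [LinearOrder V] [LinearOrder C]
variable {p p' : V → C} {Q P P' : V → Prop} {T : ℕ} {a : ℕ → V}

theorem exists_greedy [Finite V] (p : V → C) (Q : V → Prop) (T : ℕ) (r : V)
    (h : ∃ v, HasChain (Desc p) Q T v ∧ p r < p v) : ∃ a, a 0 = r ∧ Greedy p Q T a := by
  let D : ℕ → V → V → Prop := fun k u v =>
    HasChain (Desc p) Q (T - k) v ∧ p u < p v ∧ (k ≠ 0 → v < u)
  have hD : ∀ k u, ∃ v, (∃ w, D k u w) → D k u v ∧ ∀ w, D k u w → p v ≤ p w := by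
    intro k u
    by_cases hw : ∃ w, D k u w
    · obtain ⟨v, hv, hmin⟩ := Set.exists_min_image {w | D k u w} p (Set.toFinite _) hw
      exact ⟨v, fun _ => ⟨hv, hmin⟩⟩
    -- An arbitrary default, never used in the first `T` steps by `hex` below.
    · exact ⟨u, fun h => absurd h hw⟩
  choose nxt hnxt using hD
  let a : ℕ → V := fun n => Nat.rec r (fun k u => nxt k u) n
  have hex : ∀ k < T, ∃ w, D k (a k) w := by
    intro k
    induction k with
    | zero =>
      intro _
      obtain ⟨v, hv, hr⟩ := h
      exact ⟨v, hv, hr, fun h => absurd rfl h⟩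
    | succ k ih =>
      intro hk
      have hc := (hnxt k (a k) (ih (by omega))).1.1
      change HasChain _ _ _ (a (k + 1)) at hc
      obtain ⟨m, hm⟩ : ∃ m, T - k = m + 1 + 1 := ⟨T - k - 2, by omega⟩
      rw [hm] at hc
      cases hc with
      | cons _ hr hc =>
        exact ⟨_, by rw [show T - (k + 1) = m + 1 by omega]; exact hc, hr.2, fun _ => hr.1⟩
  have ha : ∀ k < T, D k (a k) (a (k + 1)) ∧ ∀ w, D k (a k) w → p (a (k + 1)) ≤ p w :=
    fun k hk => hnxt k (a k) (hex k hk)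
  exact ⟨a, rfl, fun k hk => (ha k hk).1.1.mem, fun k hk => (ha k hk).1.2.1,
    fun k hk => (ha (k + 1) hk).1.2.2 (by omega),
    fun k hk v h1 h2 h3 => (ha k hk).2 v ⟨h1, h2, h3⟩⟩

theorem unique {b : ℕ → V} (hinj : Function.Injective p) (ga : Greedy p Q T a)
    (gb : Greedy p Q T b) (h0 : a 0 = b 0) : ∀ k ≤ T, a k = b k := by
  have key : ∀ {a b : ℕ → V}, Greedy p Q T a → Greedy p Q T b → ∀ k < T, a k = b k →
      p (a (k + 1)) ≤ p (b (k + 1)) := by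
    intro a b ga gb k hk e
    refine ga.min k hk _ (gb.hasChain hk) (e ▸ gb.col k hk) fun h => e ▸ ?_
    exact gb.row_lt (by omega) (Nat.lt_succ_self k) (by omega)
  intro k
  induction k with
  | zero => exact fun _ => h0
  | succ k ih =>
    intro hk
    have e := ih (by omega)
    exact hinj (le_antisymm (key ga gb k hk e) (key gb ga k hk e.symm))

theorem _root_.EvenShapeWilf.Moved.unique {V C : Type*} {p p' p'' : V → C} {T : ℕ} {a b : ℕ → V}
    (ma : Moved p p' T a) (mb : Moved p p'' T b) (h : ∀ k ≤ T, a k = b k) : p' = p'' := by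
  funext v
  by_cases hv : ∃ k ≤ T, v = a k
  · obtain ⟨_ | k, hk, rfl⟩ := hv
    · rw [ma.zero, h 0 hk, mb.zero, h T le_rfl]
    · rw [ma.succ k hk, h (k + 1) hk, mb.succ k hk, h k (by omega)]
  · push Not at hv
    rw [ma.other v hv, mb.other v fun k hk => h k hk ▸ hv k hk]

theorem le_top (g : Greedy p Q T a) (htop : ∀ k < T, a (k + 1) < a 0) {j k : ℕ} (hjk : j < k)
    (hk : k ≤ T) : a k < a j := by
  rcases j with _ | j
  · obtain ⟨k, rfl⟩ : ∃ l, k = l + 1 := ⟨k - 1, by omega⟩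
    exact htop k hk
  · exact g.row_lt (by omega) hjk hk

/-- After the move `a (s + 1)` and `a (s + 2)` occupy the columns of `a s` and `a (s + 1)`, both
left of `w`. So they can replace `w` as soon as its successor is below `a (s + 2)`; until then the
bound on `Q`-chains from `w` keeps the successor to the right of `a (s + 2)`. -/
theorem cross_moved (g : Greedy p Q T a) (mv : Moved p p' T a) (hinj : Function.Injective p)
    (hcol : ∀ w, P' w → p' w < p (a T))
    (hQ : ∀ w, P' w → (∀ k ≤ T, w ≠ a k) → w < a 0 → Q w)
    (hP' : ∀ w, ∀ k < T, P' w → p (a k) < p' w → P' (a (k + 1))) {k : ℕ} {w : V}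
    (h : HasChain (Desc p') P' k w) :
    ∀ s < T, p (a (s + 1)) < p' w → a (s + 1) < w → w < a 0 → (∀ k ≤ T, w ≠ a k) →
      ¬ HasChain (Desc p) Q (T - s + 1) w → HasChain (Desc p') P' (k + 1) (a (s + 1)) := by
  have key : ∀ {w : V}, P' w → ∀ s < T, p (a (s + 1)) < p' w → s + 1 < T ∧ P' (a (s + 1)) ∧
      P' (a (s + 2)) ∧ Desc p' (a (s + 1)) (a (s + 2)) := by
    intro w hw s hs h1
    have hsT : s + 1 < T := g.lt_of_col_lt (by omega) (h1.trans (hcol w hw))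
    refine ⟨hsT, hP' w s hs hw ((g.col s hs).trans h1), hP' w (s + 1) hsT hw h1, g.row s hsT, ?_⟩
    rw [mv.succ s hs, mv.succ (s + 1) hsT]
    exact g.col s hs
  induction h with
  | single hw =>
    intro s hs h1 _ _ _ _
    obtain ⟨-, hP1, hP2, hD⟩ := key hw s hs h1
    exact .cons hP1 hD (.single hP2)
  | @cons k w w' hw hr hc ih =>
    intro s hs h1 h2 h3 h4 h5
    obtain ⟨hsT, hP1, hP2, hD⟩ := key hw s hs h1
    have hr2 : p' w < p' w' := hr.2
    rcases lt_trichotomy w' (a (s + 2)) with h | h | h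
    · refine .cons hP1 hD (.cons hP2 ⟨h, ?_⟩ hc)
      rw [mv.succ (s + 1) hsT]
      exact h1.trans hr2
    · rw [h, mv.succ (s + 1) hsT] at hr2
      exact absurd h1 hr2.not_gt
    have hne : ∀ k ≤ T, w' ≠ a k := by
      rintro (_ | q) hq rfl
      · exact lt_asymm hr.1 h3
      · rw [mv.succ q hq] at hr2
        have := g.lt_of_col_lt (by omega) (h1.trans hr2)
        exact lt_asymm h (g.row_lt (by omega) (by omega) hq)
    have hw0 : w' < a 0 := hr.1.trans h3
    have hwQ := hQ w hw h4 h3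
    rw [mv.other w h4, mv.other w' hne] at hr2
    refine .cons hP1 hD (ih (s + 1) hsT ?_ h hw0 hne fun hch => ?_)
    · rw [mv.other w' hne]
      by_contra hlt
      apply h5
      have hlt' : p w' < p (a (s + 2)) :=
        lt_of_le_of_ne (not_lt.mp hlt) fun e => hne _ hsT (hinj e)
      convert HasChain.cons hwQ ⟨hr.1, hr2⟩ (HasChain.cons (hQ w' hc.mem hne hw0) ⟨h, hlt'⟩
        (g.hasChain hsT)) using 1
      omega
    · apply h5
      convert HasChain.cons hwQ ⟨hr.1, hr2⟩ hch using 1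
      omega

/-- Left of the last column of the move, a chain of the original configuration gives a chain of
the moved one from the same column. -/
theorem hasChain_moved_of (g : Greedy p Q T a) (mv : Moved p p' T a)
    (hinj : Function.Injective p) (htop : ∀ k < T, a (k + 1) < a 0)
    (hno : ∀ v, ¬ HasChain (Desc p) Q (T + 1) v) {σ : V → V} (hσ : ∀ v, p' (σ v) = p v)
    (hσa : ∀ k < T, σ (a k) = a (k + 1)) (hσo : ∀ v, (∀ k ≤ T, v ≠ a k) → σ v = v)
    (hPP' : ∀ v, P v → P' (σ v))
    (hcol : ∀ w, P w → p w < p (a T)) (hcol' : ∀ w, P' w → p' w < p (a T))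
    (hQ : ∀ w, P w → w < a 0 → Q w)
    (hQ' : ∀ w, P' w → (∀ k ≤ T, w ≠ a k) → w < a 0 → Q w)
    (hP' : ∀ w, ∀ k < T, P' w → p (a k) < p' w → P' (a (k + 1))) {k : ℕ} {v : V}
    (h : HasChain (Desc p) P k v) : HasChain (Desc p') P' k (σ v) := by
  have hle : ∀ w, P w → σ w ≤ w := by
    intro w hw
    by_cases hs : ∃ k ≤ T, w = a k
    · obtain ⟨k, hk, rfl⟩ := hs
      have hkT := g.lt_of_col_lt hk (hcol _ hw)
      rw [hσa k hkT]
      exact (g.le_top htop (Nat.lt_succ_self k) hkT).le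
    · push Not at hs
      exact (hσo w hs).le
  induction h with
  | single hv => exact .single (hPP' _ hv)
  | @cons k v w hv hr hc ih =>
    by_cases hlt : σ w < σ v
    · exact .cons (hPP' _ hv) ⟨hlt, by rw [hσ, hσ]; exact hr.2⟩ ih
    -- A broken descent has `v = a j` and a fixed `w` in a row between `a (j + 1)` and `a j`. By the
    -- greedy choice `w` is to the right of `a (j + 1)`, and `cross_moved` reroutes the chain.
    have hs : ∃ k ≤ T, v = a k := by
      by_contra hs
      push Not at hs
      exact hlt ((hle w hc.mem).trans_lt (hr.1.trans_eq (hσo v hs).symm))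
    obtain ⟨j, hj, rfl⟩ := hs
    have hjT := g.lt_of_col_lt hj (hcol _ hv)
    have hne : ∀ k ≤ T, w ≠ a k := by
      rintro q hq rfl
      have hqT := g.lt_of_col_lt hq (hcol _ hc.mem)
      have := g.lt_of_col_lt hj hr.2
      apply hlt
      rw [hσa q hqT, hσa j hjT]
      exact g.row_lt (by omega) (by omega) hqT
    rw [hσo w hne] at ih hlt
    rw [hσa j hjT] at hlt ⊢
    have hlt' : a (j + 1) < w := lt_of_le_of_ne (not_lt.mp hlt) (hne _ hjT).symm
    have hw0 : w < a 0 := by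
      rcases Nat.eq_zero_or_pos j with rfl | h0
      · exact hr.1
      · exact hr.1.trans (g.le_top htop h0 hj)
    have hwQ := hQ w hc.mem hw0
    refine g.cross_moved mv hinj hcol' hQ' hP' ih j hjT ?_ hlt' hw0 hne fun hch => ?_
    · rw [mv.other w hne]
      by_contra hcon
      have hc1 : p w < p (a (j + 1)) :=
        lt_of_le_of_ne (not_lt.mp hcon) fun e => hne _ hjT (hinj e)
      have hch : HasChain (Desc p) Q (T - j + 1) w :=
        .cons hwQ ⟨hlt', hc1⟩ (g.hasChain hjT)
      exact absurd (g.min j hjT w (hch.le (by omega) (by omega)) hr.2 fun _ => hr.1)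
        (not_le.mpr hc1)
    · rcases j with _ | j
      · exact hno w hch
      · exact hno _ ((g.hasChain_add (by omega) (.cons (g.mem j (by omega)) hr hch)).le
          (by omega) (by omega))

/-- Climb both chains. A predecessor `w'` above `a s` can be followed by `a s, a (s + 1)`. One below
`a s` starts a longer `Q`-chain, so the greedy choice puts it left of `a (s - 1)`, and the climb
continues; at `s = 0` the longer chain is already excluded. -/
theorem cross_swap (g : Greedy p Q T a) (hinj : Function.Injective p)
    (htop : ∀ k < T, a (k + 1) < a 0) (hno : ∀ v, ¬ HasChain (Desc p) Q (T + 1) v)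
    (hQ : ∀ w, P w → w < a 0 → Q w) (hP : ∀ k < T, P (a (k + 1)) → P (a k)) {k : ℕ} {w : V}
    (h : HasChain (Function.swap (Desc p)) P k w) :
    ∀ s < T, P (a (s + 1)) → p w < p (a s) → HasChain (Desc p) Q (T - s) w →
      HasChain (Function.swap (Desc p)) P (k + 1) (a (s + 1)) := by
  have hD : ∀ s < T, Desc p (a s) (a (s + 1)) := fun s hs =>
    ⟨g.le_top htop (Nat.lt_succ_self s) hs, g.col s hs⟩
  induction h with
  | single hw => exact fun s hs hPs _ _ => .cons hPs (hD s hs) (.single (hP s hs hPs))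
  | @cons k w w' hw hr hc ih =>
    intro s hs hPs h1 h2
    have hr2 : p w' < p w := hr.2
    rcases lt_trichotomy w' (a s) with h | h | h
    · have hw0 : w' < a 0 := by
        rcases Nat.eq_zero_or_pos s with rfl | h0
        · exact h
        · exact h.trans (g.le_top htop h0 hs.le)
      have hch : HasChain (Desc p) Q (T - s + 1) w' := .cons (hQ w' hc.mem hw0) hr h2
      rcases s with _ | s
      · exact absurd hch (hno w')
      refine .cons hPs (hD _ hs) (ih s (by omega) (hP _ hs hPs) ?_ (hch.le (by omega) (by omega)))
      by_contra hcon
      have hlt : p (a s) < p w' := by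
        refine lt_of_le_of_ne (not_lt.mp hcon) fun e => ?_
        rw [← hinj e] at h
        exact lt_asymm h (g.le_top htop (Nat.lt_succ_self s) hs.le)
      refine absurd (g.min s (by omega) w' (hch.le (by omega) (by omega)) hlt fun h0 => ?_)
        (not_le.mpr (hr2.trans h1))
      exact h.trans (g.le_top htop (Nat.lt_succ_self s) hs.le)
    · rw [h] at hr2
      exact absurd h1 hr2.not_gt
    · exact .cons hPs (hD s hs) (.cons (hP s hs hPs) ⟨h, hr2.trans h1⟩ hc)

/-- Left of the last column of the move, a chain of the moved configuration gives a chain of the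
original one ending in the same column. -/
theorem hasChain_swap_of_moved (g : Greedy p Q T a) (hinj : Function.Injective p)
    (htop : ∀ k < T, a (k + 1) < a 0)
    (hno : ∀ v, ¬ HasChain (Desc p) Q (T + 1) v) {σ : V → V} (hσs : Function.Surjective σ)
    (hσ : ∀ v, p' (σ v) = p v)
    (hσa : ∀ k < T, σ (a k) = a (k + 1)) (hσo : ∀ v, (∀ k ≤ T, v ≠ a k) → σ v = v)
    (hPP' : ∀ v, P' (σ v) → P v)
    (hcol : ∀ w, P w → p w < p (a T))
    (hQ : ∀ w, P w → w < a 0 → Q w) (hP : ∀ k < T, P (a (k + 1)) → P (a k)) {k : ℕ} {v' : V}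
    (h : HasChain (Function.swap (Desc p')) P' k v') :
    ∀ v, σ v = v' → HasChain (Function.swap (Desc p)) P k v := by
  have hle : ∀ w, P w → σ w ≤ w := by
    intro w hw
    by_cases hs : ∃ k ≤ T, w = a k
    · obtain ⟨k, hk, rfl⟩ := hs
      have hkT := g.lt_of_col_lt hk (hcol _ hw)
      rw [hσa k hkT]
      exact (g.le_top htop (Nat.lt_succ_self k) hkT).le
    · push Not at hs
      exact (hσo w hs).le
  induction h with
  | single hv => rintro v rfl; exact .single (hPP' _ hv)
  | @cons k v' u' hv hr hc ih =>
    rintro v rfl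
    obtain ⟨u, rfl⟩ := hσs u'
    have ih := ih u rfl
    have hPv := hPP' _ hv
    have hr1 : σ v < σ u := hr.1
    have hr2 : p u < p v := by
      have : p' (σ u) < p' (σ v) := hr.2
      rwa [hσ, hσ] at this
    rcases lt_trichotomy v u with h | h | h
    · exact .cons hPv ⟨h, hr2⟩ ih
    · exact absurd hr2 (by rw [h]; exact lt_irrefl _)
    have hlt : σ v < u := hr1.trans_le (hle u ih.mem)
    have hs : ∃ k ≤ T, v = a k := by
      by_contra hs
      push Not at hs
      rw [hσo v hs] at hlt
      exact lt_asymm h hlt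
    obtain ⟨j, hj, rfl⟩ := hs
    have hjT := g.lt_of_col_lt hj (hcol _ hPv)
    rw [hσa j hjT] at hlt
    have hne : ∀ k ≤ T, u ≠ a k := by
      rintro q hq rfl
      exact lt_asymm h (g.le_top htop (g.lt_of_col_lt hq hr2) hj)
    have hu0 : u < a 0 := by
      rcases Nat.eq_zero_or_pos j with rfl | h0
      · exact h
      · exact h.trans (g.le_top htop h0 hj)
    have hch : HasChain (Desc p) Q (T - j + 1) u :=
      .cons (hQ u ih.mem hu0) ⟨hlt, hr2.trans (g.col j hjT)⟩ (g.hasChain hjT)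
    rcases j with _ | j
    · exact absurd hch (hno u)
    refine g.cross_swap hinj htop hno hQ hP ih j (by omega) hPv ?_ (hch.le (by omega) (by omega))
    by_contra hcon
    have hlt' : p (a j) < p u :=
      lt_of_le_of_ne (not_lt.mp hcon) fun e => hne j (by omega) (hinj e).symm
    refine absurd (g.min j (by omega) u (hch.le (by omega) (by omega)) hlt' fun h0 => ?_)
      (not_le.mpr hr2)
    exact h.trans (g.le_top htop (Nat.lt_succ_self j) hj)

end Greedy
end EvenShapeWilf

/-! ### Patterns as chains, and the parity of the move -/

namespace EvenShapeWilf

theorem hasChain_succ_iff {V : Type*} {R : V → V → Prop} (hR : ∀ u v w, R u v → R v w → R u w)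
    {P : V → Prop} {k : ℕ} {v : V} : HasChain R P (k + 1) v ↔
      ∃ f : Fin (k + 1) → V, f 0 = v ∧ (∀ i, P (f i)) ∧ ∀ i j, i < j → R (f i) (f j) := by
  induction k generalizing v with
  | zero =>
    constructor
    · intro h
      exact ⟨fun _ => v, rfl, fun _ => h.mem, fun i j hij => absurd hij (by omega)⟩
    · rintro ⟨f, rfl, h, -⟩
      exact .single (h 0)
  | succ k ih =>
    constructor
    · intro h
      cases h with
      | @cons _ _ w hv hr hc =>
        obtain ⟨f, rfl, hP, hf⟩ := ih.mp hc
        refine ⟨Fin.cons v f, rfl, ?_, ?_⟩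
        · intro i
          refine Fin.cases hv (fun i => ?_) i
          simpa using hP i
        · intro i j
          refine Fin.cases ?_ (fun j => ?_) j
          · intro h
            exact absurd h (Fin.not_lt_zero i)
          refine Fin.cases ?_ (fun i => ?_) i
          · intro _
            simp only [Fin.cons_zero, Fin.cons_succ]
            rcases Fin.eq_zero_or_eq_succ j with rfl | ⟨j, rfl⟩
            · exact hr
            · exact hR _ _ _ hr (hf _ _ (Fin.succ_pos j))
          · intro h
            simpa using hf i j (Fin.succ_lt_succ_iff.mp h)
    · rintro ⟨f, rfl, hP, hf⟩
      refine .cons (hP 0) (hf 0 1 (by simp)) (ih.mpr ⟨fun i => f i.succ, rfl, fun i => hP _, ?_⟩)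
      exact fun i j hij => hf _ _ (Fin.succ_lt_succ_iff.mpr hij)

theorem Desc.trans {V C : Type*} [LinearOrder V] [LinearOrder C] {p : V → C} (u v w : V)
    (h : Desc p u v) (h' : Desc p v w) : Desc p u w :=
  ⟨h'.1.trans h.1, h.2.trans h'.2⟩

variable (Y : YoungDiagram)

/-- The transversal `π` has in `Y` a decreasing pattern of `T + 1` points, the first of which lies
in row `s`. -/
def JTop (π : Equiv.Perm (Fin (numRows Y))) (T : ℕ) (s : Fin (numRows Y)) : Prop :=
  HasChain (Desc π.symm) (fun v => ((s : ℕ), (π.symm v : ℕ)) ∈ Y) (T + 1) s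

/-- The point of `π` in row `s` is the largest point of a pattern `F (T + 1)`. -/
def FTop {n : ℕ} (π : Equiv.Perm (Fin n)) (T : ℕ) (s : Fin n) : Prop :=
  ∃ v, HasChain (Desc π.symm) (fun v => v < s ∧ π.symm v < π.symm s) T v

variable {Y}

theorem mem_of_le {r r' c c' : ℕ} (h : (r, c) ∈ Y) (hr : r' ≤ r) (hc : c' ≤ c) : (r', c') ∈ Y :=
  Y.isLowerSet (show ((r', c') : ℕ × ℕ) ≤ (r, c) from ⟨hr, hc⟩) h

theorem containsIn_of_rows {π : Equiv.Perm (Fin (numRows Y))} {k : ℕ} {σ : Equiv.Perm (Fin k)}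
    (g : Fin k → Fin (numRows Y)) (hg : StrictMono fun i => π.symm (g i))
    (hσ : ∀ i j, g i < g j ↔ σ i < σ j)
    (hY : ∀ i j, ((g i : ℕ), (π.symm (g j) : ℕ)) ∈ Y) : ContainsIn Y π σ :=
  ⟨OrderEmbedding.ofStrictMono _ hg, fun i j => by simpa using hσ i j,
    fun i j => by simpa using hY i j⟩

theorem containsIn_J_iff {π : Equiv.Perm (Fin (numRows Y))} {T : ℕ} :
    ContainsIn Y π (J (T + 1)) ↔ ∃ s, JTop Y π T s := by
  constructor
  · rintro ⟨e, he, hY⟩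
    refine ⟨π (e 0), (hasChain_succ_iff Desc.trans).mpr ⟨fun i => π (e i), rfl, fun i => ?_,
      fun i j hij => ⟨?_, ?_⟩⟩⟩
    · simpa using hY 0 i
    · exact (he j i).mpr (by simpa [J] using hij)
    · simpa using hij
  · rintro ⟨s, hs⟩
    obtain ⟨f, rfl, hP, hf⟩ := (hasChain_succ_iff Desc.trans).mp hs
    have hanti : StrictAnti f := fun i j hij => (hf i j hij).1
    refine containsIn_of_rows f (fun i j hij => (hf i j hij).2) (fun i j => ?_) fun i j => ?_
    · rw [hanti.lt_iff_gt]
      simp [J]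
    · exact mem_of_le (hP j) (hanti.antitone (Fin.zero_le i)) le_rfl

theorem F_castSucc {T : ℕ} (i : Fin T) : (F (T + 1) i.castSucc : ℕ) = T - 1 - i := by
  have : (i : ℕ) + 1 < T + 1 := by omega
  simp only [F, Function.Involutive.coe_toPerm, FFun, Fin.val_castSucc, this, dif_pos]
  omega

theorem F_last (T : ℕ) : F (T + 1) (Fin.last T) = Fin.last T := by
  simp [F, FFun]

theorem F_lt_iff {T : ℕ} (i j : Fin T) :
    F (T + 1) i.castSucc < F (T + 1) j.castSucc ↔ j < i := by
  rw [Fin.lt_def, F_castSucc, F_castSucc, Fin.lt_def]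
  omega

theorem F_castSucc_lt_last {T : ℕ} (i : Fin T) :
    F (T + 1) i.castSucc < F (T + 1) (Fin.last T) := by
  rw [Fin.lt_def, F_castSucc, F_last, Fin.val_last]
  omega

/-- The largest letter of `F` is also its last, so the corner of the square is a point of the
transversal: the shape imposes no further condition. -/
theorem containsIn_F_iff {π : Equiv.Perm (Fin (numRows Y))} {T : ℕ} (hT : 1 ≤ T)
    (hπ : IsTransversal Y π) : ContainsIn Y π (F (T + 1)) ↔ ∃ s, FTop π T s := by
  obtain ⟨k, rfl⟩ : ∃ k, T = k + 1 := ⟨T - 1, by omega⟩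
  constructor
  · rintro ⟨e, he, hY⟩
    refine ⟨π (e (Fin.last _)), π (e 0), (hasChain_succ_iff Desc.trans).mpr
      ⟨fun i => π (e i.castSucc), rfl, fun i => ⟨?_, ?_⟩, fun i j hij => ⟨?_, ?_⟩⟩⟩
    · exact (he _ _).mpr (F_castSucc_lt_last i)
    · simp
    · exact (he _ _).mpr ((F_lt_iff _ _).mpr hij)
    · simpa using hij
  · rintro ⟨s, v, hs⟩
    obtain ⟨f, rfl, hP, hf⟩ := (hasChain_succ_iff Desc.trans).mp hs
    let g : Fin (k + 2) → Fin (numRows Y) := Fin.snoc (α := fun _ => Fin (numRows Y)) f s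
    have hgc : ∀ i : Fin (k + 1), g i.castSucc = f i := fun i => Fin.snoc_castSucc ..
    have hgl : g (Fin.last _) = s := Fin.snoc_last ..
    have hanti : StrictAnti f := fun i j hij => (hf i j hij).1
    refine containsIn_of_rows g (fun i j hij => ?_) (fun i j => ?_) fun i j => ?_
    · induction i using Fin.lastCases with
      | last => exact absurd hij (not_lt.mpr (Fin.le_last j))
      | cast i =>
        induction j using Fin.lastCases with
        | last => simpa only [hgc, hgl] using (hP i).2
        | cast j => simpa only [hgc] using (hf i j (by simpa using hij)).2
    · induction i using Fin.lastCases with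
      | last =>
        induction j using Fin.lastCases with
        | last => simp
        | cast j =>
          rw [hgc, hgl]
          exact iff_of_false (hP j).1.not_gt (F_castSucc_lt_last j).not_gt
      | cast i =>
        induction j using Fin.lastCases with
        | last =>
          rw [hgc, hgl]
          exact iff_of_true (hP i).1 (F_castSucc_lt_last i)
        | cast j => rw [hgc, hgc, hanti.lt_iff_gt, F_lt_iff]
    · have hs : ((s : ℕ), (π.symm s : ℕ)) ∈ Y := by simpa using hπ (π.symm s)
      have h1 : ∀ i, g i ≤ s := fun i => by
        induction i using Fin.lastCases with
        | last => rw [hgl]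
        | cast i => rw [hgc]; exact (hP i).1.le
      have h2 : ∀ i, π.symm (g i) ≤ π.symm s := fun i => by
        induction i using Fin.lastCases with
        | last => rw [hgl]
        | cast i => rw [hgc]; exact (hP i).2.le
      exact mem_of_le hs (h1 i) (h2 j)

theorem exists_moved {n T : ℕ} (hT : Even T) (π : Equiv.Perm (Fin n)) (a : ℕ → Fin n)
    (ha : ∀ j ≤ T, ∀ k ≤ T, a j = a k → j = k) :
    ∃ π' : Equiv.Perm (Fin n), Moved π.symm π'.symm T a ∧
      Equiv.Perm.sign π' = Equiv.Perm.sign π := by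
  let f : Fin (T + 1) ↪ Fin n := ⟨fun k => a k, fun j k h =>
    Fin.ext (ha j (by omega) k (by omega) h)⟩
  let σ : Equiv.Perm (Fin n) := (finRotate (T + 1)).viaFintypeEmbedding f
  have hσ : ∀ k, σ (f k) = f (finRotate (T + 1) k) :=
    fun k => Equiv.Perm.viaFintypeEmbedding_apply_image ..
  refine ⟨σ * π, ⟨fun k hk => ?_, ?_, fun v hv => ?_⟩, ?_⟩
  · rw [Equiv.symm_apply_eq, Equiv.Perm.mul_apply, Equiv.apply_symm_apply]
    have := hσ ⟨k, by omega⟩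
    rw [finRotate_of_lt hk] at this
    exact this.symm
  · rw [Equiv.symm_apply_eq, Equiv.Perm.mul_apply, Equiv.apply_symm_apply]
    have := hσ (Fin.last T)
    rw [finRotate_last] at this
    exact this.symm
  · rw [Equiv.symm_apply_eq, Equiv.Perm.mul_apply, Equiv.apply_symm_apply]
    refine (Equiv.Perm.viaFintypeEmbedding_apply_notMem_range _ _ ?_).symm
    rintro ⟨k, rfl⟩
    exact hv k (by omega) rfl
  · rw [Equiv.Perm.sign_mul, Equiv.Perm.viaFintypeEmbedding_sign, sign_finRotate,
      Nat.add_sub_cancel, hT.neg_one_pow,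
      one_mul]

theorem HasChain.and_le {V C : Type*} [LinearOrder V] [LinearOrder C] {p : V → C} {P : V → Prop}
    {k : ℕ} {v : V} (h : HasChain (Desc p) P k v) :
    HasChain (Desc p) (fun w => w ≤ v ∧ P w) k v := by
  induction h with
  | single h => exact .single ⟨le_rfl, h⟩
  | cons h hr _ ih =>
    exact .cons ⟨le_rfl, h⟩ hr (ih.mono (fun _ _ h => h) fun _ hw => ⟨hw.1.trans hr.1.le, hw.2⟩)

end EvenShapeWilf

/-! ### The move at a fixed row `r` -/

namespace EvenShapeWilf

/-- The rows below `r` whose points lie in columns that meet row `r`. -/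
def lowerRows (Y : YoungDiagram) (r : Fin (numRows Y)) (π : Equiv.Perm (Fin (numRows Y)))
    (v : Fin (numRows Y)) : Prop := v < r ∧ ((r : ℕ), (π.symm v : ℕ)) ∈ Y

/-- `π'` is obtained from `π` by turning the greedy occurrence `a` of `J (T + 1)` with its first
point in row `r` into an occurrence of `F (T + 1)`. -/
structure Step (Y : YoungDiagram) (r : Fin (numRows Y)) (T : ℕ)
    (π π' : Equiv.Perm (Fin (numRows Y))) (a : ℕ → Fin (numRows Y)) : Prop where
  zero : a 0 = r
  cell : ((r : ℕ), (π.symm r : ℕ)) ∈ Y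
  greedy : Greedy π.symm (lowerRows Y r π) T a
  moved : Moved π.symm π'.symm T a
  no_chain : ∀ v, ¬ HasChain (Desc π.symm) (lowerRows Y r π) (T + 1) v

variable {Y : YoungDiagram} {r : Fin (numRows Y)} {T : ℕ} {π π' : Equiv.Perm (Fin (numRows Y))}
  {a : ℕ → Fin (numRows Y)}

theorem isTransversal_iff : IsTransversal Y π ↔
    ∀ v : Fin (numRows Y), ((v : ℕ), (π.symm v : ℕ)) ∈ Y :=
  ⟨fun h v => by simpa using h (π.symm v), fun h i => by simpa using h (π i)⟩

theorem not_lowerRows_self : ¬ lowerRows Y r π r := fun h => lt_irrefl _ h.1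

namespace Step

theorem top (h : Step Y r T π π' a) : ∀ k < T, a (k + 1) < a 0 := fun k hk =>
  h.zero ▸ (h.greedy.mem k hk).1

theorem not_mem_zero (h : Step Y r T π π' a) : ¬ lowerRows Y r π (a 0) := by
  rw [h.zero]
  exact not_lowerRows_self

theorem le (h : Step Y r T π π' a) {k : ℕ} (hk : k ≤ T) : a k ≤ r := by
  rcases k with _ | k
  · exact h.zero.le
  · exact (h.zero ▸ h.top k hk).le

theorem cell_of_le (h : Step Y r T π π' a) {k : ℕ} (hk : k ≤ T) :
    ((r : ℕ), (π.symm (a k) : ℕ)) ∈ Y := by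
  rcases k with _ | k
  · rw [h.zero]
    exact h.cell
  · exact (h.greedy.mem k hk).2

theorem cell_moved (h : Step Y r T π π' a) {k : ℕ} (hk : k ≤ T) :
    ((r : ℕ), (π'.symm (a k) : ℕ)) ∈ Y := by
  rcases k with _ | k
  · rw [h.moved.zero]
    exact h.cell_of_le le_rfl
  · rw [h.moved.succ k hk]
    exact h.cell_of_le (by omega)

/-- All permuted columns meet row `r`, hence every lower row. -/
theorem cell_iff (h : Step Y r T π π' a) {s : Fin (numRows Y)} (hs : s ≤ r)
    (v : Fin (numRows Y)) : ((s : ℕ), (π'.symm v : ℕ)) ∈ Y ↔ ((s : ℕ), (π.symm v : ℕ)) ∈ Y := by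
  by_cases hv : ∃ k ≤ T, v = a k
  · obtain ⟨k, hk, rfl⟩ := hv
    exact iff_of_true (mem_of_le (h.cell_moved hk) hs le_rfl)
      (mem_of_le (h.cell_of_le hk) hs le_rfl)
  · push Not at hv
    rw [h.moved.other v hv]

theorem lowerRows_eq (h : Step Y r T π π' a) : lowerRows Y r π' = lowerRows Y r π := by
  funext v
  exact propext (and_congr_right fun _ => h.cell_iff le_rfl v)

theorem isTransversal (h : Step Y r T π π' a) : IsTransversal Y π' ↔ IsTransversal Y π := by
  rw [isTransversal_iff, isTransversal_iff]
  refine forall_congr' fun v => ?_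
  by_cases hv : ∃ k ≤ T, v = a k
  · obtain ⟨k, hk, rfl⟩ := hv
    exact h.cell_iff (h.le hk) _
  · push Not at hv
    rw [h.moved.other v hv]

theorem dual (h : Step Y r T π π' a) :
    Greedy (V := (Fin (numRows Y))ᵒᵈ) (C := (Fin (numRows Y))ᵒᵈ) π'.symm (lowerRows Y r π) T
      (rev T a) :=
  h.greedy.dual h.moved π.symm.injective h.not_mem_zero h.no_chain

theorem jTop (h : Step Y r T π π' a) (hT : 1 ≤ T) : JTop Y π T r := by
  refine .cons h.cell ⟨h.zero ▸ h.top 0 hT, h.zero ▸ h.greedy.col 0 hT⟩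
    ((h.greedy.hasChain hT).mono (fun _ _ h => h) fun v hv => hv.2)

theorem fTop (h : Step Y r T π π' a) (hT : 1 ≤ T) : FTop π' T r := by
  refine ⟨a 1, h.greedy.hasChain_moved h.moved (fun k hk => ⟨h.zero ▸ h.top k hk, ?_⟩) hT⟩
  rw [← h.zero, h.moved.zero, h.moved.succ k hk]
  exact h.greedy.col_lt hk le_rfl

theorem jTop_of_moved (h : Step Y r T π π' a) {s : Fin (numRows Y)} (hs : s < r)
    (hJ : JTop Y π' T s) : JTop Y π T s := by
  have hJ' : HasChain (Desc π'.symm) (fun v => v < r ∧ ((s : ℕ), (π.symm v : ℕ)) ∈ Y) (T + 1) s :=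
    hJ.and_le.mono (fun _ _ h => h) fun v hv => ⟨hv.1.trans_lt hs, (h.cell_iff hs.le v).mp hv.2⟩
  refine (h.greedy.hasChain_of_moved h.moved π.symm.injective ?_ ?_ ?_ hJ').mono
    (fun _ _ h => h) fun v hv => hv.2
  · rintro w hw rfl
    exact hw.1.ne h.zero
  · intro w k hk _ _
    exact ⟨h.zero ▸ h.top k hk, mem_of_le (h.cell_of_le hk) hs.le le_rfl⟩
  · intro w hw _ hlt
    exact ⟨hw.1, mem_of_le (h.cell_of_le le_rfl) le_rfl hlt.le⟩

/-- This is the dual of `jTop_of_moved`. With reversed orders a chain keeps its lowest row rather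
than its highest, so the first point may change rows; the condition `v ≤ s` carried along keeps it
below `r`. -/
theorem exists_jTop_moved (h : Step Y r T π π' a) {s : Fin (numRows Y)} (hs : s < r)
    (hJ : JTop Y π T s) : ∃ s' < r, JTop Y π' T s' := by
  obtain ⟨w, hw⟩ := hJ.and_le.exists_swap
  have hw' : HasChain (Function.swap (Desc π'.symm))
      (fun v => v ≤ s ∧ ((s : ℕ), (π.symm v : ℕ)) ∈ Y) (T + 1) w := by
    refine h.dual.hasChain_of_moved h.moved.symm π'.symm.injective ?_ ?_ ?_ hw
    · rintro w hw rfl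
      exact (hw.1.trans_lt hs).ne h.zero
    · intro w k hk hw hlt
      refine ⟨le_of_lt (lt_of_lt_of_le hlt hw.1), ?_⟩
      change ((s : ℕ), (π.symm (rev (V := Fin (numRows Y)) T a (k + 1)) : ℕ)) ∈ Y
      rw [rev_succ]
      exact mem_of_le (h.cell_of_le (by omega)) hs.le le_rfl
    · intro w hw hlt _
      replace hlt : π'.symm w < π'.symm (a 0) := hlt
      refine ⟨hw.1.trans_lt hs, (h.cell_iff le_rfl w).mp ?_⟩
      exact mem_of_le (h.cell_moved (Nat.zero_le T)) le_rfl hlt.le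
  obtain ⟨u, hu⟩ := hw'.exists_of_swap
  refine ⟨u, hu.mem.1.trans_lt hs, hu.mono (fun _ _ h => h) fun v hv => ?_⟩
  exact mem_of_le ((h.cell_iff hs.le v).mpr hv.2) hu.mem.1 le_rfl

theorem symm_eq (h : Step Y r T π π' a) {s : Fin (numRows Y)} (hs : r < s) :
    π'.symm s = π.symm s :=
  h.moved.other s fun _ hk e => (h.le hk).not_gt (e ▸ hs)

theorem shift (h : Step Y r T π π' a) {k : ℕ} (hk : k < T) : π' (π.symm (a k)) = a (k + 1) := by
  rw [← h.moved.succ k hk, Equiv.apply_symm_apply]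

theorem shift_other (h : Step Y r T π π' a) {v : Fin (numRows Y)} (hv : ∀ k ≤ T, v ≠ a k) :
    π' (π.symm v) = v := by
  rw [← h.moved.other v hv, Equiv.apply_symm_apply]

theorem shift_last (h : Step Y r T π π' a) : π' (π.symm (a T)) = a 0 := by
  rw [← h.moved.zero, Equiv.apply_symm_apply]

theorem shift_lt_iff (h : Step Y r T π π' a) {s : Fin (numRows Y)} (hs : r < s)
    (v : Fin (numRows Y)) : π' (π.symm v) < s ↔ v < s := by
  by_cases hv : ∃ k ≤ T, v = a k
  · obtain ⟨k, hk, rfl⟩ := hv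
    refine iff_of_true ?_ ((h.le hk).trans_lt hs)
    rcases Nat.lt_or_ge k T with hkT | hkT
    · rw [h.shift hkT]
      exact (h.le hkT).trans_lt hs
    · obtain rfl : k = T := by omega
      rw [h.shift_last]
      exact (h.le (Nat.zero_le _)).trans_lt hs
  · push Not at hv
    rw [h.shift_other hv]

theorem fTop_iff (h : Step Y r T π π' a) (hT : 1 ≤ T) (hπ : IsTransversal Y π)
    {s : Fin (numRows Y)} (hs : r < s) : FTop π' T s ↔ FTop π T s := by
  have hcell := isTransversal_iff.mp hπ s
  unfold FTop
  rw [h.symm_eq hs]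
  -- If the whole move happens to the left of the point in row `s`, the greedy chain is a witness
  -- both before and after. Otherwise only columns left of the last one of the move matter.
  rcases lt_or_ge (π.symm (a T)) (π.symm s) with hlt | hge
  · refine iff_of_true ⟨a 1, h.greedy.hasChain_moved h.moved (fun k hk => ⟨?_, ?_⟩) hT⟩
      ⟨a 1, h.greedy.hasChain_of_mem (fun k hk => ⟨?_, ?_⟩) hT⟩
    · exact (h.le hk).trans_lt hs
    · rw [h.moved.succ k hk]
      exact (h.greedy.col_lt hk le_rfl).trans hlt
    · exact (h.le hk).trans_lt hs
    · rcases Nat.eq_or_lt_of_le (show k + 1 ≤ T from hk) with e | hk'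
      · rw [e]
        exact hlt
      · exact (h.greedy.col_lt hk' le_rfl).trans hlt
  have hQ : ∀ w, w < a 0 → π.symm w < π.symm s → lowerRows Y r π w := fun w hw hws =>
    ⟨h.zero ▸ hw, mem_of_le hcell hs.le hws.le⟩
  constructor
  · rintro ⟨v, hv⟩
    obtain ⟨w, hw⟩ := hv.exists_swap
    refine (h.greedy.hasChain_swap_of_moved (p' := π'.symm) (σ := fun v => π' (π.symm v))
      (P := fun v => v < s ∧ π.symm v < π.symm s) π.symm.injective h.top h.no_chain
      ?_ ?_ (fun k hk => h.shift hk)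
      (fun v hv => h.shift_other hv) ?_ ?_ ?_ ?_ hw (π (π'.symm w)) (by simp)).exists_of_swap
    · exact π'.surjective.comp π.symm.surjective
    · intro v
      simp
    · rintro v ⟨h1, h2⟩
      exact ⟨(h.shift_lt_iff hs v).mp h1, by simpa using h2⟩
    · exact fun w hw => hw.2.trans_le hge
    · exact fun w hw hw0 => hQ w hw0 hw.2
    · exact fun k hk hw => ⟨(h.le hk.le).trans_lt hs, (h.greedy.col k hk).trans hw.2⟩
  · rintro ⟨v, hv⟩
    refine ⟨π' (π.symm v), h.greedy.hasChain_moved_of h.moved (σ := fun v => π' (π.symm v))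
      (P := fun v => v < s ∧ π.symm v < π.symm s) π.symm.injective h.top h.no_chain ?_
      (fun k hk => h.shift hk) (fun v hv => h.shift_other hv) ?_ ?_ ?_ ?_ ?_ ?_ hv⟩
    · intro v
      simp
    · rintro v ⟨h1, h2⟩
      exact ⟨(h.shift_lt_iff hs v).mpr h1, by simpa using h2⟩
    · exact fun w hw => hw.2.trans_le hge
    · exact fun w hw => hw.2.trans_le hge
    · exact fun w hw hw0 => hQ w hw0 hw.2
    · intro w hw hne hw0
      exact hQ w hw0 (h.moved.other w hne ▸ hw.2)
    · intro w k hk hw hlt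
      refine ⟨(h.le hk).trans_lt hs, ?_⟩
      rw [h.moved.succ k hk]
      exact hlt.trans hw.2

theorem right_unique {π'' : Equiv.Perm (Fin (numRows Y))} {b : ℕ → Fin (numRows Y)}
    (h : Step Y r T π π' a) (h' : Step Y r T π π'' b) : π' = π'' := by
  have := h.moved.unique h'.moved
    (h.greedy.unique π.symm.injective h'.greedy (h.zero.trans h'.zero.symm))
  exact Equiv.symm_bijective.injective (DFunLike.coe_injective this)

theorem left_unique {π'' : Equiv.Perm (Fin (numRows Y))} {b : ℕ → Fin (numRows Y)}
    (h : Step Y r T π π' a) (h' : Step Y r T π'' π' b) : π = π'' := by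
  have hd := h'.dual
  rw [← h'.lowerRows_eq, h.lowerRows_eq] at hd
  have := h.moved.symm.unique h'.moved.symm
    (Greedy.unique (V := (Fin (numRows Y))ᵒᵈ) (C := (Fin (numRows Y))ᵒᵈ) π'.symm.injective
      h.dual hd (h.zero.trans h'.zero.symm))
  exact Equiv.symm_bijective.injective (DFunLike.coe_injective this)

end Step

/-! ### Existence of the move, and the count row by row -/

theorem Greedy.injOn {V C : Type*} [LinearOrder V] [LinearOrder C] {p : V → C} {Q : V → Prop}
    {T : ℕ} {a : ℕ → V} (g : Greedy p Q T a) : ∀ j ≤ T, ∀ k ≤ T, a j = a k → j = k := by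
  intro j hj k hk e
  rcases lt_trichotomy j k with h | h | h
  · exact absurd (congrArg p e) (g.col_lt h hk).ne
  · exact h
  · exact absurd (congrArg p e) (g.col_lt h hj).ne'

theorem not_hasChain_lowerRows (hJ : ∀ s < r, ¬ JTop Y π T s) (v : Fin (numRows Y)) :
    ¬ HasChain (Desc π.symm) (lowerRows Y r π) (T + 1) v := fun h =>
  hJ v h.mem.1 (h.mono (fun _ _ h => h) fun _ hu => mem_of_le hu.2 h.mem.1.le le_rfl)

theorem exists_step_of_jTop (hT : Even T) (hT1 : 1 ≤ T) (hπ : IsTransversal Y π)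
    (hJ : ∀ s < r, ¬ JTop Y π T s) (hr : JTop Y π T r) :
    ∃ π' a, Step Y r T π π' a ∧ Equiv.Perm.sign π' = Equiv.Perm.sign π := by
  have hex : ∃ v, HasChain (Desc π.symm) (lowerRows Y r π) T v ∧ π.symm r < π.symm v := by
    obtain ⟨k, rfl⟩ : ∃ k, T = k + 1 := ⟨T - 1, by omega⟩
    cases hr with
    | cons _ hd hc =>
      exact ⟨_, hc.and_le.mono (fun _ _ h => h) fun v hv => ⟨hv.1.trans_lt hd.1, hv.2⟩, hd.2⟩
  obtain ⟨a, ha, g⟩ := Greedy.exists_greedy _ _ _ _ hex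
  obtain ⟨π', mv, hs⟩ := exists_moved hT π a g.injOn
  exact ⟨π', a, ⟨ha, isTransversal_iff.mp hπ r, g, mv, not_hasChain_lowerRows hJ⟩, hs⟩

/-- For the reversed orders an occurrence of `F` at `r` is a start for the greedy construction;
`Greedy.dual` turns the resulting move around. -/
theorem exists_step_of_fTop (hT : Even T) (hπ : IsTransversal Y π')
    (hJ : ∀ s < r, ¬ JTop Y π' T s) (hr : FTop π' T r) :
    ∃ π a, Step Y r T π π' a ∧ Equiv.Perm.sign π' = Equiv.Perm.sign π := by
  have hcell := isTransversal_iff.mp hπ r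
  obtain ⟨v, hv⟩ := hr
  obtain ⟨w, hw⟩ := hv.exists_swap
  have hch : HasChain (Function.swap (Desc π'.symm)) (lowerRows Y r π') T w :=
    hw.mono (fun _ _ h => h) fun v hv => ⟨hv.1, mem_of_le hcell le_rfl hv.2.le⟩
  obtain ⟨b, hb, g⟩ := Greedy.exists_greedy (V := (Fin (numRows Y))ᵒᵈ) (C := (Fin (numRows Y))ᵒᵈ)
    π'.symm (lowerRows Y r π') T r ⟨w, hch, hw.mem.2⟩
  obtain ⟨π, mv, hs⟩ := exists_moved hT π' b g.injOn
  have h0 : ¬ lowerRows Y r π' (b 0) := by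
    rw [hb]
    exact not_lowerRows_self
  have hno : ∀ v, ¬ HasChain (Function.swap (Desc π'.symm)) (lowerRows Y r π') (T + 1) v := by
    intro v hv
    obtain ⟨u, hu⟩ := hv.exists_of_swap
    exact not_hasChain_lowerRows hJ u hu
  have hcb : ∀ k ≤ T, ((r : ℕ), (π'.symm (b k) : ℕ)) ∈ Y := by
    rintro (_ | k) hk
    · rw [hb]
      exact hcell
    · exact (g.mem k hk).2
  have hQ : lowerRows Y r π = lowerRows Y r π' := by
    funext v
    refine propext (and_congr_right fun _ => ?_)
    by_cases hv : ∃ k ≤ T, v = b k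
    · obtain ⟨_ | k, hk, rfl⟩ := hv
      · rw [mv.zero]
        exact iff_of_true (hcb T le_rfl) (hcb 0 hk)
      · rw [mv.succ k hk]
        exact iff_of_true (hcb k (by omega)) (hcb _ hk)
    · push Not at hv
      rw [mv.other v hv]
  refine ⟨π, rev T b, ⟨hb, ?_, ?_, mv.symm, ?_⟩, hs.symm⟩
  · have := mv.zero
    rw [hb] at this
    rw [this]
    exact hcb T le_rfl
  · rw [hQ]
    exact g.dual mv π'.symm.injective h0 hno
  · intro v hv
    rw [hQ] at hv
    obtain ⟨u, hu⟩ := hv.exists_swap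
    exact g.not_hasChain_moved mv π'.symm.injective h0 hno u hu

/-- The even transversals without `J (T + 1)` with first point in a row below `r` and without
`F (T + 1)` with largest point in a row above `r`. -/
def hybrid (Y : YoungDiagram) (T : ℕ) (r : Fin (numRows Y)) :
    Set (Equiv.Perm (Fin (numRows Y))) :=
  {π | IsTransversal Y π ∧ Equiv.Perm.sign π = 1 ∧ (∀ s < r, ¬ JTop Y π T s) ∧
    ∀ s, r < s → ¬ FTop π T s}

theorem Step.mem_hybrid_iff (h : Step Y r T π π' a) (hT : 1 ≤ T)
    (hs : Equiv.Perm.sign π' = Equiv.Perm.sign π) : π' ∈ hybrid Y T r ↔ π ∈ hybrid Y T r := by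
  unfold hybrid
  simp only [Set.mem_ofPred_eq]
  rw [h.isTransversal, hs]
  refine and_congr_right fun hπ => and_congr_right fun _ => and_congr ⟨?_, ?_⟩ ?_
  · intro hJ s hs hJs
    obtain ⟨s', hs', hJ'⟩ := h.exists_jTop_moved hs hJs
    exact hJ s' hs' hJ'
  · exact fun hJ s hs hJs => hJ s hs (h.jTop_of_moved hs hJs)
  · exact forall_congr' fun s => forall_congr' fun hs => not_congr (h.fTop_iff hT hπ hs)

theorem ncard_hybrid_jTop (hT : Even T) (hT1 : 1 ≤ T) :
    (hybrid Y T r ∩ {π | JTop Y π T r}).ncard = (hybrid Y T r ∩ {π | FTop π T r}).ncard := by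
  have h1 : ∀ π ∈ hybrid Y T r ∩ {π | JTop Y π T r}, ∃ π' a, Step Y r T π π' a ∧
      Equiv.Perm.sign π' = Equiv.Perm.sign π := fun π hπ =>
    exists_step_of_jTop hT hT1 hπ.1.1 hπ.1.2.2.1 hπ.2
  choose! f a hf hfs using h1
  refine Set.ncard_congr (fun π _ => f π) (fun π hπ => ?_) (fun π π' hπ hπ' e => ?_) fun π' hπ' => ?_
  · exact ⟨((hf π hπ).mem_hybrid_iff hT1 (hfs π hπ)).mpr hπ.1, (hf π hπ).fTop hT1⟩
  · have := hf π' hπ'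
    rw [← e] at this
    exact (hf π hπ).left_unique this
  · obtain ⟨π, b, hb, hs⟩ := exists_step_of_fTop hT hπ'.1.1 hπ'.1.2.2.1 hπ'.2
    have hπ : π ∈ hybrid Y T r ∩ {π | JTop Y π T r} :=
      ⟨(hb.mem_hybrid_iff hT1 hs).mp hπ'.1, hb.jTop hT1⟩
    exact ⟨π, hπ, (hf π hπ).right_unique hb⟩

/-- The even transversals without `J (T + 1)` with first point in one of the `r` lowest rows and
without `F (T + 1)` with largest point in another row. -/
def stage (Y : YoungDiagram) (T r : ℕ) : Set (Equiv.Perm (Fin (numRows Y))) :=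
  {π | IsTransversal Y π ∧ Equiv.Perm.sign π = 1 ∧ (∀ s : Fin (numRows Y), s < r → ¬ JTop Y π T s) ∧
    ∀ s : Fin (numRows Y), r ≤ s → ¬ FTop π T s}

theorem stage_eq (r : Fin (numRows Y)) :
    stage Y T r = hybrid Y T r \ {π | FTop π T r} := by
  ext π
  simp only [stage, hybrid, Set.mem_ofPred_eq, Set.mem_sdiff, Fin.val_fin_lt, Fin.val_fin_le]
  constructor
  · rintro ⟨h1, h2, h3, h4⟩
    exact ⟨⟨h1, h2, h3, fun s hs => h4 s hs.le⟩, h4 r le_rfl⟩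
  · rintro ⟨⟨h1, h2, h3, h4⟩, h5⟩
    refine ⟨h1, h2, h3, fun s hs => ?_⟩
    rcases hs.eq_or_lt with rfl | hs
    exacts [h5, h4 s hs]

theorem stage_succ_eq (r : Fin (numRows Y)) :
    stage Y T (r + 1) = hybrid Y T r \ {π | JTop Y π T r} := by
  ext π
  simp only [stage, hybrid, Set.mem_ofPred_eq, Set.mem_sdiff, Order.lt_add_one_iff,
    Order.add_one_le_iff, Fin.val_fin_lt, Fin.val_fin_le]
  constructor
  · rintro ⟨h1, h2, h3, h4⟩
    exact ⟨⟨h1, h2, fun s hs => h3 s hs.le, h4⟩, h3 r le_rfl⟩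
  · rintro ⟨⟨h1, h2, h3, h4⟩, h5⟩
    refine ⟨h1, h2, fun s hs => ?_, h4⟩
    rcases hs.eq_or_lt with rfl | hs
    exacts [h5, h3 s hs]

theorem ncard_stage (hT : Even T) (hT1 : 1 ≤ T) {r : ℕ} (hr : r ≤ numRows Y) :
    (stage Y T r).ncard = (stage Y T 0).ncard := by
  induction r with
  | zero => rfl
  | succ r ih =>
    rw [← ih (by omega)]
    have h1 := stage_eq (Y := Y) (T := T) ⟨r, hr⟩
    have h2 := stage_succ_eq (Y := Y) (T := T) ⟨r, hr⟩
    simp only at h1 h2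
    rw [h1, h2]
    have h3 := Set.ncard_inter_add_ncard_sdiff_eq_ncard (hybrid Y T ⟨r, hr⟩)
      {π | JTop Y π T ⟨r, hr⟩} (Set.toFinite _)
    have h4 := Set.ncard_inter_add_ncard_sdiff_eq_ncard (hybrid Y T ⟨r, hr⟩)
      {π | FTop π T ⟨r, hr⟩} (Set.toFinite _)
    rw [ncard_hybrid_jTop hT hT1] at h3
    omega

theorem evenAvoiders_J_eq : evenAvoiders Y (J (T + 1)) = stage Y T (numRows Y) := by
  ext π
  simp only [evenAvoiders, stage, Set.mem_ofPred_eq, containsIn_J_iff, not_exists]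
  refine and_congr_right fun _ => and_congr_right fun _ => ?_
  exact ⟨fun h => ⟨fun s _ => h s, fun s hs => absurd s.isLt (not_lt.mpr hs)⟩,
    fun h s => h.1 s s.isLt⟩

theorem evenAvoiders_F_eq (hT : 1 ≤ T) : evenAvoiders Y (F (T + 1)) = stage Y T 0 := by
  ext π
  simp only [evenAvoiders, stage, Set.mem_ofPred_eq]
  refine and_congr_right fun hπ => and_congr_right fun _ => ?_
  rw [containsIn_F_iff hT hπ, not_exists]
  exact ⟨fun h => ⟨fun s hs => absurd hs (Nat.not_lt_zero _), fun s _ => h s⟩,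
    fun h s => h.2 s (Nat.zero_le _)⟩

end EvenShapeWilf

theorem mainTheorem1 (t : ℕ) (ht : Odd t) :
    EvenShapeWilf.EvenShapeWilfEquiv (EvenShapeWilf.J t) (EvenShapeWilf.F t) := by
  obtain ⟨m, rfl⟩ := ht
  intro Y
  rcases Nat.eq_zero_or_pos m with rfl | hm
  -- For `t = 1` there is no chain beside the largest point, and the two patterns coincide.
  · have h : EvenShapeWilf.J (2 * 0 + 1) = EvenShapeWilf.F (2 * 0 + 1) :=
      Equiv.ext fun i => Subsingleton.elim (α := Fin 1) _ _
    rw [h]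
  · rw [EvenShapeWilf.evenAvoiders_J_eq, EvenShapeWilf.evenAvoiders_F_eq (by omega),
      EvenShapeWilf.ncard_stage (even_two_mul m) (by omega) le_rfl]
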